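/- Let $p,q$ be probability vectors on $\{1,\dots,n\}$, let $\Sigma=\mathrm{Diag}(\sigma_1,\dots,\sigma_n)$ with all $\sigma_i\ge 0$, and suppose $\Delta:=(p-q)^{\mathsf T}\Sigma(p-q)>0$. Let $(x_t)_{t\in\mathbb Z}$ be independent $\{1,\dots,n\}$-valued samples with $x_t\sim p$ for $t<0$ (reference samples) and $x_t\sim q$ for $t\ge 0$ (the change occurs at time $0$); write $\mathbb E_0$ for the expectation. For integers $0\le k\le t$ put $M=\lceil (t-k)/2\rceil$ and $$\chi_{t,k}=M\,(\xi_{t,k}-\eta_{t,k})^{\mathsf T}\,\Sigma\,(\xi'_{t,k}-\eta'_{t,k})\quad(\chi_{t,t}=0),$$ where $\xi_{t,k},\xi'_{t,k},\eta_{t,k},\eta'_{t,k}$ are the empirical distributions of the four consecutive blocks of $M$ samples which start at the times $k-2M,\ k-M,\ k,\ k+M$, respectively. For a threshold $b$ consider the scan procedure and its window-limited version, $$\mathcal T=\inf\{t\ge 0:\max_{0\le k\le t}\chi_{t,k}\ge b\},\qquad \mathcal T'=\inf\{t\ge 0:\max_{0\le k\le t,\ m_0\le t-k\le m_1}\chi_{t,k}\ge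 b\}$$ (with $\inf\emptyset=\infty$). Then, as $b\to\infty$ with $p,q,\Sigma$ held fixed: (a) $\displaystyle \mathbb E_0[\mathcal T]=\frac{b\,(1+o(1))}{(p-q)^{\mathsf T}\Sigma(p-q)/2}.$ (b) Suppose in addition that $\sigma_i>0$ and $0<q_i<1$ for some $i$. Then there is a constant $C>2/\Delta$, depending only on $p,q,\Sigma$, such that for every fixed $m_0$ and all window sizes $m_1=m_1(b)\ge Cb$ (sufficiently large windows, in particular $m_1>2b/[(p-q)^{\mathsf T}\Sigma(p-q)]$), $$\mathbb E_0[\mathcal T']=\frac{b\,(1+o(1))}{(p-q)^{\mathsf T}\Sigma(p-q)/2}.$$ -/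

import Mathlib

open MeasureTheory ProbabilityTheory Filter Topology
open scoped ENNReal

universe u

noncomputable section

/-- The weighted bilinear form `uᵀ Σ v` with the diagonal weight matrix `Σ = Diag(σ)`. -/
def weightedForm {n : ℕ} (σ u v : Fin n → ℝ) : ℝ := ∑ i, σ i * u i * v i

/-- The empirical distribution of the `M` consecutive samples `x s, x (s+1), …, x (s+M-1)`. -/
def empirical {n : ℕ} (x : ℤ → Fin n) (s : ℤ) (M : ℕ) : Fin n → ℝ :=
  fun a => (((Finset.range M).filter (fun j : ℕ => x (s + (j : ℤ)) = a)).card : ℝ) / (M : ℝ)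

/-- The common sample length `⌈(t - k) / 2⌉` (for `k ≤ t`). -/
def halfLength (t k : ℕ) : ℕ := (t - k + 1) / 2

/-- The detection statistic `χ_{t,k} = M (ξ - η)ᵀ Σ (ξ' - η')` with `M = ⌈(t - k) / 2⌉`:
`ξ, ξ', η, η'` are the empirical distributions of four consecutive blocks of `M` samples, the first
two filling the times `k - 2M, …, k - 1` and the last two the times `k, …, k + 2M - 1`, which lie in
`[k, t]`. For `k = t` it is `0`. -/
def detectionStat {n : ℕ} (σ : Fin n → ℝ) (x : ℤ → Fin n) (t k : ℕ) : ℝ :=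
  let M : ℕ := halfLength t k
  (M : ℝ) * weightedForm σ
    (empirical x ((k : ℤ) - 2 * (M : ℤ)) M - empirical x (k : ℤ) M)
    (empirical x ((k : ℤ) - (M : ℤ)) M - empirical x ((k : ℤ) + (M : ℤ)) M)

/-- The scan procedure `inf {t : max_{0 ≤ k ≤ t} χ_{t,k} ≥ b}`, equal to `∞` if it never stops. -/
def scanTime {n : ℕ} (σ : Fin n → ℝ) (b : ℝ) (x : ℤ → Fin n) : ℕ∞ :=
  ⨅ (t : ℕ) (_ : ∃ k : ℕ, k ≤ t ∧ b ≤ detectionStat σ x t k), (t : ℕ∞)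

/-- The window-limited scan procedure `inf {t : max_{m₀ ≤ t - k ≤ m₁} χ_{t,k} ≥ b}`, over the
candidate change-points `0 ≤ k ≤ t`, equal to `∞` if it never stops. -/
def windowScanTime {n : ℕ} (σ : Fin n → ℝ) (m₀ m₁ : ℕ) (b : ℝ) (x : ℤ → Fin n) : ℕ∞ :=
  ⨅ (t : ℕ) (_ : ∃ k : ℕ, k ≤ t ∧ m₀ ≤ t - k ∧ t - k ≤ m₁ ∧ b ≤ detectionStat σ x t k), (t : ℕ∞)

/-- The samples `X t`, `t ∈ ℤ`, are independent, with distribution `p` at the times `t < 0` (the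
reference samples) and distribution `q` at the times `t ≥ 0`: the change happens at time `0`. -/
structure ChangeAtZero {n : ℕ} {Ω : Type*} [MeasurableSpace Ω] (μ : Measure Ω)
    (p q : Fin n → ℝ) (X : ℤ → Ω → Fin n) : Prop where
  measurable : ∀ t, Measurable (X t)
  indep : iIndepFun X μ
  pre : ∀ t : ℤ, t < 0 → ∀ a, μ.real {ω | X t ω = a} = p a
  post : ∀ t : ℤ, 0 ≤ t → ∀ a, μ.real {ω | X t ω = a} = q a

/-- The expectation, in `[0, ∞]`, of a random time with values in `ℕ ∪ {∞}` that is a function of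
the whole sample sequence. -/
def expectedTime {n : ℕ} {Ω : Type*} [MeasurableSpace Ω] (μ : Measure Ω) (X : ℤ → Ω → Fin n)
    (T : (ℤ → Fin n) → ℕ∞) : ℝ≥0∞ :=
  ∫⁻ ω, ((T (fun t => X t ω) : ℕ∞) : ℝ≥0∞) ∂μ

end

/-! Write Δ for the quadratic form at `p - q` and S for `∑ i, σ i`. If all four blocks are δ-close
to their means, χ differs by at most 4δMS from its value at the means. Since k ≥ 0, the last two
blocks have mean `q`, and the means of the first two are mixtures of `p` and `q`; so that value is
αβMΔ with α, β in [0, 1], and exactly MΔ at k = 0. By Hoeffding, failures of closeness are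
exponentially rare in M.

Lower bound: χ ≤ MS, so a crossing of b needs M ≥ b/S. Before time N ≈ cb with c < 2/Δ one has M ≤
N/2, so a crossing also needs a block far from its mean. The union over N² pairs (t, k) costs only a
polynomial factor against an exponential in b (`measureReal_scanTime_lt_le`). The window-limited
procedure stops no earlier, so it inherits the bound.

Upper bound for the scan: the candidate k = 0 alone has crossed at each time t ≥ cb, c > 2/Δ,
outside an event of probability O(exp(-at)); these tails are summable.

Upper bound for the window: k = 0 is lost after time m₁, so the tail sum is not available. After a
miss at N₂ ≈ Cb one waits for an accidental crossing instead: 2M samples i followed by 2M samples j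
force χ ≥ Mσᵢ ≥ b. The expected wait is exponential in b, but it is weighted by the probability of
the miss, at most of order exp(-a₀Cb); a large C keeps the product bounded
(`expectedTime_windowScanTime_le`). -/

/-- The distribution of the sample at time `t`: `p` before the change, `q` after it. -/
def sampleLaw {n : ℕ} (p q : Fin n → ℝ) (t : ℤ) : Fin n → ℝ := if t < 0 then p else q

/-- The average distribution of the `M` samples which start at time `s`. -/
noncomputable def blockMean {n : ℕ} (p q : Fin n → ℝ) (s : ℤ) (M : ℕ) : Fin n → ℝ :=
  fun a => (∑ j ∈ Finset.range M, sampleLaw p q (s + (j : ℤ)) a) / (M : ℝ)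

/-- The empirical distribution of a block is coordinatewise `δ`-close to its mean. -/
def BlockClose {n : ℕ} (p q : Fin n → ℝ) (δ : ℝ) (x : ℤ → Fin n) (s : ℤ) (M : ℕ) : Prop :=
  ∀ a, |empirical x s M a - blockMean p q s M a| < δ

/-- All four blocks which enter the detection statistic at `(t, k)` are close to their means. -/
def BlocksClose {n : ℕ} (p q : Fin n → ℝ) (δ : ℝ) (x : ℤ → Fin n) (t k : ℕ) : Prop :=
  BlockClose p q δ x ((k : ℤ) - 2 * (halfLength t k : ℤ)) (halfLength t k) ∧
  BlockClose p q δ x ((k : ℤ) - (halfLength t k : ℤ)) (halfLength t k) ∧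
  BlockClose p q δ x (k : ℤ) (halfLength t k) ∧
  BlockClose p q δ x ((k : ℤ) + (halfLength t k : ℤ)) (halfLength t k)

/-! ### The statistic at and near the block means. -/

section Deterministic

variable {n : ℕ} {p q σ : Fin n → ℝ}

lemma abs_sub_le_one_of_mem_Icc {a b : ℝ} (ha : a ∈ Set.Icc (0 : ℝ) 1)
    (hb : b ∈ Set.Icc (0 : ℝ) 1) : |a - b| ≤ 1 := by
  rw [abs_le]
  exact ⟨by linarith [ha.1, hb.2], by linarith [ha.2, hb.1]⟩

lemma stdSimplex_apply_mem_Icc (hp : p ∈ stdSimplex ℝ (Fin n)) (a : Fin n) :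
    p a ∈ Set.Icc (0 : ℝ) 1 := mem_Icc_of_mem_stdSimplex hp a

lemma empirical_mem_Icc (x : ℤ → Fin n) (s : ℤ) (M : ℕ) (a : Fin n) :
    empirical x s M a ∈ Set.Icc (0 : ℝ) 1 := by
  unfold empirical
  refine ⟨by positivity, div_le_one_of_le₀ ?_ (by positivity)⟩
  exact_mod_cast (Finset.card_filter_le _ _).trans (by simp)

lemma sampleLaw_mem_stdSimplex (hp : p ∈ stdSimplex ℝ (Fin n)) (hq : q ∈ stdSimplex ℝ (Fin n))
    (t : ℤ) : sampleLaw p q t ∈ stdSimplex ℝ (Fin n) := by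
  unfold sampleLaw
  split_ifs <;> assumption

lemma blockMean_post {s : ℤ} {M : ℕ} (hM : 0 < M) (hs : 0 ≤ s) : blockMean p q s M = q := by
  funext a
  have h : ∀ j ∈ Finset.range M, sampleLaw p q (s + (j : ℤ)) a = q a := fun j _ => by
    rw [sampleLaw, if_neg (by omega)]
  have : (M : ℝ) ≠ 0 := by positivity
  rw [blockMean, Finset.sum_congr rfl h]
  simp
  field_simp

lemma blockMean_pre {s : ℤ} {M : ℕ} (hM : 0 < M) (hs : s + M ≤ 0) : blockMean p q s M = p := by
  funext a
  have h : ∀ j ∈ Finset.range M, sampleLaw p q (s + (j : ℤ)) a = p a := fun j hj => by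
    rw [Finset.mem_range] at hj
    rw [sampleLaw, if_pos (by omega)]
  have : (M : ℝ) ≠ 0 := by positivity
  rw [blockMean, Finset.sum_congr rfl h]
  simp
  field_simp

/-- The coefficient α is the fraction of the block that lies before time 0. -/
lemma exists_blockMean_sub_eq_smul (p q : Fin n → ℝ) {s : ℤ} {M : ℕ} (hM : 0 < M) :
    ∃ α ∈ Set.Icc (0 : ℝ) 1, ∀ a, blockMean p q s M a - q a = α * (p a - q a) := by
  have hM' : (0 : ℝ) < M := by positivity
  refine ⟨(∑ j ∈ Finset.range M, if s + (j : ℤ) < 0 then (1 : ℝ) else 0) / M, ⟨?_, ?_⟩, ?_⟩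
  · exact div_nonneg (Finset.sum_nonneg fun j _ => by split_ifs <;> norm_num) hM'.le
  · rw [div_le_one hM']
    calc _ ≤ ∑ j ∈ Finset.range M, (1 : ℝ) :=
          Finset.sum_le_sum fun j _ => by split_ifs <;> norm_num
      _ = M := by simp
  · intro a
    have h : ∀ j ∈ Finset.range M, sampleLaw p q (s + (j : ℤ)) a
        = (if s + (j : ℤ) < 0 then (1 : ℝ) else 0) * (p a - q a) + q a := fun j _ => by
      unfold sampleLaw
      split_ifs <;> ring
    rw [blockMean, Finset.sum_congr rfl h, Finset.sum_add_distrib, ← Finset.sum_mul]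
    simp
    field_simp
    ring

lemma blockMean_mem_Icc (hp : p ∈ stdSimplex ℝ (Fin n)) (hq : q ∈ stdSimplex ℝ (Fin n))
    (s : ℤ) (M : ℕ) (a : Fin n) : blockMean p q s M a ∈ Set.Icc (0 : ℝ) 1 := by
  have h := fun j : ℕ => stdSimplex_apply_mem_Icc (sampleLaw_mem_stdSimplex hp hq (s + (j : ℤ))) a
  refine ⟨div_nonneg (Finset.sum_nonneg fun j _ => (h j).1) (by positivity),
    div_le_one_of_le₀ ?_ (by positivity)⟩
  calc _ ≤ ∑ j ∈ Finset.range M, (1 : ℝ) := Finset.sum_le_sum fun j _ => (h j).2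
    _ = M := by simp

lemma abs_weightedForm_sub_le (hσ : ∀ i, 0 ≤ σ i) {u v u' v' : Fin n → ℝ} {ε : ℝ}
    (hv : ∀ a, |v a| ≤ 1) (hu' : ∀ a, |u' a| ≤ 1)
    (hu : ∀ a, |u a - u' a| ≤ ε) (hvv : ∀ a, |v a - v' a| ≤ ε) :
    |weightedForm σ u v - weightedForm σ u' v'| ≤ 2 * ε * ∑ i, σ i := by
  unfold weightedForm
  rw [← Finset.sum_sub_distrib, Finset.mul_sum]
  refine (Finset.abs_sum_le_sum_abs _ _).trans (Finset.sum_le_sum fun i _ => ?_)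
  have h : σ i * u i * v i - σ i * u' i * v' i
      = σ i * ((u i - u' i) * v i + u' i * (v i - v' i)) := by ring
  have h1 : |(u i - u' i) * v i| ≤ ε * 1 := by
    rw [abs_mul]
    exact mul_le_mul (hu i) (hv i) (abs_nonneg _) ((abs_nonneg _).trans (hu i))
  have h2 : |u' i * (v i - v' i)| ≤ 1 * ε := by
    rw [abs_mul]
    exact mul_le_mul (hu' i) (hvv i) (abs_nonneg _) zero_le_one
  rw [h, abs_mul, abs_of_nonneg (hσ i), mul_comm (2 * ε)]
  refine mul_le_mul_of_nonneg_left ((abs_add_le _ _).trans ?_) (hσ i)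
  linarith

lemma weightedForm_le_sum (hσ : ∀ i, 0 ≤ σ i) {u v : Fin n → ℝ}
    (hu : ∀ a, |u a| ≤ 1) (hv : ∀ a, |v a| ≤ 1) : weightedForm σ u v ≤ ∑ i, σ i := by
  refine Finset.sum_le_sum fun i _ => ?_
  have : u i * v i ≤ 1 := by
    refine (le_abs_self _).trans ?_
    rw [abs_mul]
    exact mul_le_one₀ (hu i) (abs_nonneg _) (hv i)
  nlinarith [hσ i]

/-- Crude, but valid for every sample path: it excludes crossings by short blocks, where
concentration is useless. -/
lemma detectionStat_le_halfLength_mul_sum (hσ : ∀ i, 0 ≤ σ i) (x : ℤ → Fin n) (t k : ℕ) :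
    detectionStat σ x t k ≤ halfLength t k * ∑ i, σ i :=
  mul_le_mul_of_nonneg_left (weightedForm_le_sum hσ
    (fun _ => abs_sub_le_one_of_mem_Icc (empirical_mem_Icc ..) (empirical_mem_Icc ..))
    (fun _ => abs_sub_le_one_of_mem_Icc (empirical_mem_Icc ..) (empirical_mem_Icc ..)))
    (by positivity)

/-- On the event that the four blocks are close to their means, the statistic is close to its
value at the block means. -/
lemma abs_detectionStat_sub_le (hp : p ∈ stdSimplex ℝ (Fin n)) (hq : q ∈ stdSimplex ℝ (Fin n))
    (hσ : ∀ i, 0 ≤ σ i) {δ : ℝ} {x : ℤ → Fin n} {t k : ℕ} (hx : BlocksClose p q δ x t k) :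
    |detectionStat σ x t k - halfLength t k * weightedForm σ
      (blockMean p q ((k : ℤ) - 2 * (halfLength t k : ℤ)) (halfLength t k)
        - blockMean p q (k : ℤ) (halfLength t k))
      (blockMean p q ((k : ℤ) - (halfLength t k : ℤ)) (halfLength t k)
        - blockMean p q ((k : ℤ) + (halfLength t k : ℤ)) (halfLength t k))|
      ≤ halfLength t k * (4 * δ * ∑ i, σ i) := by
  obtain ⟨h1, h2, h3, h4⟩ := hx
  simp only [detectionStat]
  rw [← mul_sub, abs_mul, abs_of_nonneg (by positivity : (0 : ℝ) ≤ halfLength t k)]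
  refine mul_le_mul_of_nonneg_left ?_ (by positivity)
  -- Each argument of the form is a difference of two empirical vectors, hence off by at most 2δ.
  rw [show 4 * δ * ∑ i, σ i = 2 * (2 * δ) * ∑ i, σ i by ring]
  refine abs_weightedForm_sub_le hσ
    (fun _ => abs_sub_le_one_of_mem_Icc (empirical_mem_Icc ..) (empirical_mem_Icc ..))
    (fun _ => abs_sub_le_one_of_mem_Icc (blockMean_mem_Icc hp hq ..) (blockMean_mem_Icc hp hq ..))
    (fun a => ?_) (fun a => ?_)
  · have ha := abs_lt.1 (h1 a)
    have hb := abs_lt.1 (h3 a)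
    simp only [Pi.sub_apply]
    rw [abs_le]
    exact ⟨by linarith [ha.1, hb.2], by linarith [ha.2, hb.1]⟩
  · have ha := abs_lt.1 (h2 a)
    have hb := abs_lt.1 (h4 a)
    simp only [Pi.sub_apply]
    rw [abs_le]
    exact ⟨by linarith [ha.1, hb.2], by linarith [ha.2, hb.1]⟩

/-- No candidate k beats the true change-point on average: contamination of the reference blocks by
`q` only shrinks the two differences, by factors α and β. -/
lemma detectionStat_le_of_blocksClose (hp : p ∈ stdSimplex ℝ (Fin n))
    (hq : q ∈ stdSimplex ℝ (Fin n)) (hσ : ∀ i, 0 ≤ σ i)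
    (hpq : 0 < weightedForm σ (p - q) (p - q)) {δ : ℝ} {x : ℤ → Fin n} {t k : ℕ}
    (hx : BlocksClose p q δ x t k) :
    detectionStat σ x t k
      ≤ halfLength t k * (weightedForm σ (p - q) (p - q) + 4 * δ * ∑ i, σ i) := by
  have h := (abs_le.1 (abs_detectionStat_sub_le hp hq hσ hx)).2
  rcases Nat.eq_zero_or_pos (halfLength t k) with h0 | h0
  · simp [detectionStat, h0]
  set M := halfLength t k
  obtain ⟨α, hα, hα'⟩ := exists_blockMean_sub_eq_smul p q (s := (k : ℤ) - 2 * (M : ℤ)) h0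
  obtain ⟨β, hβ, hβ'⟩ := exists_blockMean_sub_eq_smul p q (s := (k : ℤ) - (M : ℤ)) h0
  rw [blockMean_post h0 (by positivity : (0 : ℤ) ≤ k),
    blockMean_post h0 (by positivity : (0 : ℤ) ≤ (k : ℤ) + M)] at h
  have hw : weightedForm σ (blockMean p q ((k : ℤ) - 2 * (M : ℤ)) M - q)
      (blockMean p q ((k : ℤ) - (M : ℤ)) M - q) = α * β * weightedForm σ (p - q) (p - q) := by
    unfold weightedForm
    rw [Finset.mul_sum]
    refine Finset.sum_congr rfl fun i _ => ?_
    simp only [Pi.sub_apply, hα', hβ']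
    ring
  have hαβ : α * β ≤ 1 := mul_le_one₀ hα.2 hβ.1 hβ.2
  rw [hw] at h
  have h2 : (M : ℝ) * (α * β * weightedForm σ (p - q) (p - q))
      ≤ M * weightedForm σ (p - q) (p - q) :=
    mul_le_mul_of_nonneg_left (mul_le_of_le_one_left hpq.le hαβ) (by positivity)
  rw [mul_add]
  linarith

/-- At k = 0 the blocks are pure: two from `p`, two from `q`. -/
lemma le_detectionStat_zero_of_blocksClose (hp : p ∈ stdSimplex ℝ (Fin n))
    (hq : q ∈ stdSimplex ℝ (Fin n)) (hσ : ∀ i, 0 ≤ σ i) {δ : ℝ} {x : ℤ → Fin n} {t : ℕ}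
    (hx : BlocksClose p q δ x t 0) :
    halfLength t 0 * (weightedForm σ (p - q) (p - q) - 4 * δ * ∑ i, σ i)
      ≤ detectionStat σ x t 0 := by
  have h := (abs_le.1 (abs_detectionStat_sub_le hp hq hσ hx)).1
  rcases Nat.eq_zero_or_pos (halfLength t 0) with h0 | h0
  · simp [detectionStat, h0]
  set M := halfLength t 0
  rw [blockMean_post h0 (by positivity : (0 : ℤ) ≤ (0 : ℕ)),
    blockMean_post h0 (by positivity : (0 : ℤ) ≤ ((0 : ℕ) : ℤ) + M),
    blockMean_pre h0 (by push_cast; omega), blockMean_pre h0 (by push_cast; omega)] at h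
  rw [mul_sub]
  linarith

lemma weightedForm_le_sum_of_mem_stdSimplex (hp : p ∈ stdSimplex ℝ (Fin n))
    (hq : q ∈ stdSimplex ℝ (Fin n)) (hσ : ∀ i, 0 ≤ σ i) :
    weightedForm σ (p - q) (p - q) ≤ ∑ i, σ i :=
  weightedForm_le_sum hσ
    (fun a => abs_sub_le_one_of_mem_Icc (stdSimplex_apply_mem_Icc hp a)
      (stdSimplex_apply_mem_Icc hq a))
    (fun a => abs_sub_le_one_of_mem_Icc (stdSimplex_apply_mem_Icc hp a)
      (stdSimplex_apply_mem_Icc hq a))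

end Deterministic

/-! ### Hoeffding bounds for the blocks. -/

section Concentration

variable {n : ℕ} {p q σ : Fin n → ℝ} {Ω : Type*} [MeasurableSpace Ω] {X : ℤ → Ω → Fin n}

lemma empirical_eq_sum_ite (x : ℤ → Fin n) (s : ℤ) (M : ℕ) (a : Fin n) :
    empirical x s M a = (∑ j ∈ Finset.range M, if x (s + (j : ℤ)) = a then (1 : ℝ) else 0) / M := by
  simp [empirical]

lemma measurable_empirical {s : ℤ} {M : ℕ} (hX : ∀ t, s ≤ t → t < s + M → Measurable (X t))
    (a : Fin n) : Measurable fun ω => empirical (fun t => X t ω) s M a := by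
  simp only [empirical_eq_sum_ite]
  refine (Finset.measurable_sum _ fun j hj => ?_).div_const _
  rw [Finset.mem_range] at hj
  exact Measurable.ite (hX _ (by omega) (by omega) (measurableSet_singleton a))
    measurable_const measurable_const

lemma measurable_detectionStat {t k : ℕ} (hX : ∀ s : ℤ, s ≤ t → Measurable (X s)) (hkt : k ≤ t) :
    Measurable fun ω => detectionStat σ (fun s => X s ω) t k := by
  have hM : k + 2 * halfLength t k ≤ t + 1 := by unfold halfLength; omega
  simp only [detectionStat, weightedForm, Pi.sub_apply]
  refine Measurable.const_mul (Finset.measurable_sum _ fun i _ => Measurable.mul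
    (Measurable.const_mul (Measurable.sub ?_ ?_) _) (Measurable.sub ?_ ?_)) _ <;>
  exact measurable_empirical (fun s _ h => hX s (by omega)) i

variable {μ : Measure Ω}

namespace ChangeAtZero

lemma measureReal_eq_sampleLaw (h : ChangeAtZero μ p q X) (t : ℤ) (a : Fin n) :
    μ.real {ω | X t ω = a} = sampleLaw p q t a := by
  unfold sampleLaw
  split_ifs with ht
  · exact h.pre t ht a
  · exact h.post t (not_lt.1 ht) a

variable [IsProbabilityMeasure μ]

/-- A centred indicator is sub-Gaussian with variance proxy 1/4; the sign `r` covers both tails at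
once. -/
lemma measureReal_sum_indicator_sub_ge (h : ChangeAtZero μ p q X) (s : ℤ) (M : ℕ) (a : Fin n)
    {r : ℝ} (hr : r = 1 ∨ r = -1) {δ : ℝ} (hδ : 0 ≤ δ) :
    μ.real {ω | δ * M ≤ ∑ j ∈ Finset.range M,
      r * ((if X (s + (j : ℤ)) ω = a then (1 : ℝ) else 0) - sampleLaw p q (s + (j : ℤ)) a)}
      ≤ Real.exp (-(2 * δ ^ 2 * M)) := by
  have hf : ∀ t, Measurable fun ω => if X t ω = a then (1 : ℝ) else 0 := fun t =>
    Measurable.ite (h.measurable t (measurableSet_singleton a)) measurable_const measurable_const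
  have hint : ∀ t, ∫ ω, (if X t ω = a then (1 : ℝ) else 0) ∂μ = sampleLaw p q t a := fun t => by
    have hm : MeasurableSet {ω | X t ω = a} := h.measurable t (measurableSet_singleton a)
    rw [← h.measureReal_eq_sampleLaw t a, ← integral_indicator_one hm]
    simp [Set.indicator]
  have hind : iIndepFun (fun (j : ℕ) ω => r * ((if X (s + (j : ℤ)) ω = a then (1 : ℝ) else 0)
      - sampleLaw p q (s + (j : ℤ)) a)) μ := by
    have h1 : iIndepFun (fun (j : ℕ) => X (s + (j : ℤ))) μ :=
      h.indep.precomp (g := fun j : ℕ => s + (j : ℤ)) fun i j hij => by simpa using hij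
    exact h1.comp (fun j c => r * ((if c = a then (1 : ℝ) else 0) - sampleLaw p q (s + (j : ℤ)) a))
      fun _ => measurable_of_finite _
  have hsub : ∀ j < M, HasSubgaussianMGF (fun ω => r * ((if X (s + (j : ℤ)) ω = a then (1 : ℝ)
      else 0) - sampleLaw p q (s + (j : ℤ)) a)) (1 / 4) μ := fun j _ => by
    have h0 := hasSubgaussianMGF_of_mem_Icc (μ := μ) (a := 0) (b := 1)
      (hf (s + (j : ℤ))).aemeasurable (ae_of_all _ fun ω => by split_ifs <;> simp)
    rw [hint] at h0
    have hc : (‖(1 : ℝ) - 0‖₊ / 2) ^ 2 = 1 / 4 := by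
      rw [sub_zero, nnnorm_one]; norm_num
    rw [hc] at h0
    rcases hr with rfl | rfl
    · simpa using h0
    · convert h0.neg using 1
      ext ω
      simp
  refine (HasSubgaussianMGF.measure_sum_range_ge_le_of_iIndepFun hind hsub
    (by positivity)).trans (Real.exp_le_exp.2 (le_of_eq ?_))
  rcases Nat.eq_zero_or_pos M with rfl | hM
  · simp
  · have : (M : ℝ) ≠ 0 := by positivity
    push_cast
    field_simp
    ring

/-- Hoeffding's inequality for the empirical distribution of a block. -/
lemma measureReal_not_blockClose_le (h : ChangeAtZero μ p q X) {δ : ℝ} (hδ : 0 < δ)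
    (s : ℤ) (M : ℕ) :
    μ.real {ω | ¬ BlockClose p q δ (fun t => X t ω) s M}
      ≤ 2 * n * Real.exp (-(2 * δ ^ 2 * M)) := by
  let A : ℝ → Fin n → Set Ω := fun r a => {ω | δ * M ≤ ∑ j ∈ Finset.range M,
      r * ((if X (s + (j : ℤ)) ω = a then (1 : ℝ) else 0) - sampleLaw p q (s + (j : ℤ)) a)}
  have hsub : {ω | ¬ BlockClose p q δ (fun t => X t ω) s M} ⊆ ⋃ a, (A 1 a ∪ A (-1) a) := by
    intro ω hω
    simp only [BlockClose, Set.mem_ofPred_eq, not_forall, not_lt] at hω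
    obtain ⟨a, ha⟩ := hω
    refine Set.mem_iUnion.2 ⟨a, ?_⟩
    rw [empirical_eq_sum_ite, blockMean, ← sub_div, ← Finset.sum_sub_distrib] at ha
    rcases Nat.eq_zero_or_pos M with rfl | hM
    · simp at ha
      linarith
    have hM' : (0 : ℝ) < M := by positivity
    rw [abs_div, abs_of_pos hM', le_div_iff₀ hM', le_abs] at ha
    rcases ha with ha | ha
    · left
      simpa [A] using ha
    · right
      simp only [A, Set.mem_ofPred_eq, ← Finset.mul_sum]
      linarith
  calc _ ≤ μ.real (⋃ a, (A 1 a ∪ A (-1) a)) := measureReal_mono hsub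
    _ ≤ ∑ a, μ.real (A 1 a ∪ A (-1) a) := measureReal_iUnion_fintype_le _
    _ ≤ ∑ a : Fin n, 2 * Real.exp (-(2 * δ ^ 2 * M)) := by
        refine Finset.sum_le_sum fun a _ => (measureReal_union_le _ _).trans ?_
        have h1 := h.measureReal_sum_indicator_sub_ge s M a (r := 1) (Or.inl rfl) hδ.le
        have h2 := h.measureReal_sum_indicator_sub_ge s M a (r := -1) (Or.inr rfl) hδ.le
        linarith
    _ = _ := by simp; ring

lemma measureReal_not_blocksClose_le (h : ChangeAtZero μ p q X) {δ : ℝ} (hδ : 0 < δ)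
    (t k : ℕ) :
    μ.real {ω | ¬ BlocksClose p q δ (fun s => X s ω) t k}
      ≤ 8 * n * Real.exp (-(2 * δ ^ 2 * halfLength t k)) := by
  let B : ℤ → Set Ω := fun s => {ω | ¬ BlockClose p q δ (fun t => X t ω) s (halfLength t k)}
  have hB : ∀ s, μ.real (B s) ≤ 2 * n * Real.exp (-(2 * δ ^ 2 * halfLength t k)) :=
    fun s => h.measureReal_not_blockClose_le hδ s _
  have hsub : {ω | ¬ BlocksClose p q δ (fun s => X s ω) t k} ⊆
      (B ((k : ℤ) - 2 * (halfLength t k : ℤ)) ∪ B ((k : ℤ) - (halfLength t k : ℤ)))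
        ∪ (B (k : ℤ) ∪ B ((k : ℤ) + (halfLength t k : ℤ))) := by
    intro ω hω
    simp only [BlocksClose, Set.mem_ofPred_eq] at hω
    simp only [B, Set.mem_union, Set.mem_ofPred_eq]
    tauto
  refine (measureReal_mono hsub).trans ((measureReal_union_le _ _).trans ?_)
  have h1 := measureReal_union_le (μ := μ) (B ((k : ℤ) - 2 * (halfLength t k : ℤ)))
    (B ((k : ℤ) - (halfLength t k : ℤ)))
  have h2 := measureReal_union_le (μ := μ) (B (k : ℤ)) (B ((k : ℤ) + (halfLength t k : ℤ)))
  have := hB ((k : ℤ) - 2 * (halfLength t k : ℤ))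
  have := hB ((k : ℤ) - (halfLength t k : ℤ))
  have := hB (k : ℤ)
  have := hB ((k : ℤ) + (halfLength t k : ℤ))
  linarith

/-- The probability that the statistic at the true change-point has not crossed `b` by time `t`. -/
lemma measureReal_detectionStat_zero_lt_le (h : ChangeAtZero μ p q X)
    (hp : p ∈ stdSimplex ℝ (Fin n)) (hq : q ∈ stdSimplex ℝ (Fin n)) (hσ : ∀ i, 0 ≤ σ i)
    {δ b : ℝ} (hδ : 0 < δ) (hΔ : 0 ≤ weightedForm σ (p - q) (p - q) - 4 * δ * ∑ i, σ i) {t : ℕ}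
    (hb : b ≤ t / 2 * (weightedForm σ (p - q) (p - q) - 4 * δ * ∑ i, σ i)) :
    μ.real {ω | detectionStat σ (fun s => X s ω) t 0 < b} ≤ 8 * n * Real.exp (-(δ ^ 2 * t)) := by
  have hM : (t : ℝ) / 2 ≤ halfLength t 0 := by
    have : t ≤ 2 * halfLength t 0 := by unfold halfLength; omega
    have : (t : ℝ) ≤ 2 * halfLength t 0 := by exact_mod_cast this
    linarith
  have hsub : {ω | detectionStat σ (fun s => X s ω) t 0 < b}
      ⊆ {ω | ¬ BlocksClose p q δ (fun s => X s ω) t 0} := fun ω hω hc => by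
    have h1 := le_detectionStat_zero_of_blocksClose hp hq hσ hc
    have h2 := mul_le_mul_of_nonneg_right hM hΔ
    have h3 : detectionStat σ (fun s => X s ω) t 0 < b := hω
    linarith
  refine (measureReal_mono hsub).trans ((h.measureReal_not_blocksClose_le hδ t 0).trans ?_)
  refine mul_le_mul_of_nonneg_left (Real.exp_le_exp.2 ?_) (by positivity)
  nlinarith [sq_nonneg δ]

end ChangeAtZero

end Concentration

/-! ### No early stopping, and the lower bound for the mean. -/

section LowerBound

variable {n : ℕ} {p q σ : Fin n → ℝ}

lemma scanTime_le_windowScanTime (σ : Fin n → ℝ) (m₀ m₁ : ℕ) (b : ℝ) (x : ℤ → Fin n) :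
    scanTime σ b x ≤ windowScanTime σ m₀ m₁ b x :=
  le_iInf₂ fun t ⟨k, hk, _, _, hb⟩ => iInf₂_le t ⟨k, hk, hb⟩

lemma windowScanTime_le {m₀ m₁ t k : ℕ} {b : ℝ} {x : ℤ → Fin n} (hk : k ≤ t)
    (h₀ : m₀ ≤ t - k) (h₁ : t - k ≤ m₁) (hb : b ≤ detectionStat σ x t k) :
    windowScanTime σ m₀ m₁ b x ≤ t :=
  iInf₂_le t ⟨k, hk, h₀, h₁, hb⟩

lemma scanTime_le {t k : ℕ} {b : ℝ} {x : ℤ → Fin n} (hk : k ≤ t)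
    (hb : b ≤ detectionStat σ x t k) : scanTime σ b x ≤ t :=
  iInf₂_le t ⟨k, hk, hb⟩

/-- The scan procedure does not stop before time `N` if all long blocks are close to their means. -/
lemma le_scanTime_of_blocksClose (hp : p ∈ stdSimplex ℝ (Fin n))
    (hq : q ∈ stdSimplex ℝ (Fin n)) (hσ : ∀ i, 0 ≤ σ i)
    (hpq : 0 < weightedForm σ (p - q) (p - q)) {δ b : ℝ} (hδ : 0 < δ) {N : ℕ} {x : ℤ → Fin n}
    (hN : N / 2 * (weightedForm σ (p - q) (p - q) + 4 * δ * ∑ i, σ i) < b)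
    (hx : ∀ t < N, ∀ k ≤ t, b ≤ halfLength t k * ∑ i, σ i → BlocksClose p q δ x t k) :
    (N : ℕ∞) ≤ scanTime σ b x := by
  refine le_iInf₂ fun t ⟨k, hk, hb⟩ => ?_
  by_contra! htN
  have htN : t < N := by exact_mod_cast htN
  have h1 := detectionStat_le_of_blocksClose hp hq hσ hpq
    (hx t htN k hk (hb.trans (detectionStat_le_halfLength_mul_sum hσ x t k)))
  -- The strict inequality t < N absorbs the rounding up in `halfLength`.
  have hM : 2 * halfLength t k ≤ N := by unfold halfLength; omega
  have hM : 2 * (halfLength t k : ℝ) ≤ N := by exact_mod_cast hM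
  have hS : 0 ≤ ∑ i, σ i := Finset.sum_nonneg fun i _ => hσ i
  have h2 : 0 ≤ weightedForm σ (p - q) (p - q) + 4 * δ * ∑ i, σ i := by positivity
  have h3 := mul_le_mul_of_nonneg_right (by linarith : (halfLength t k : ℝ) ≤ N / 2) h2
  linarith

variable {Ω : Type*} [MeasurableSpace Ω] {X : ℤ → Ω → Fin n}
  {μ : Measure Ω} [IsProbabilityMeasure μ]

namespace ChangeAtZero

/-- With high probability the scan procedure does not stop before time `N`. -/
lemma measureReal_scanTime_lt_le (h : ChangeAtZero μ p q X)
    (hp : p ∈ stdSimplex ℝ (Fin n)) (hq : q ∈ stdSimplex ℝ (Fin n)) (hσ : ∀ i, 0 ≤ σ i)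
    (hpq : 0 < weightedForm σ (p - q) (p - q)) {δ b : ℝ} (hδ : 0 < δ) {N : ℕ}
    (hN : N / 2 * (weightedForm σ (p - q) (p - q) + 4 * δ * ∑ i, σ i) < b) :
    μ.real {ω | scanTime σ b (fun s => X s ω) < N}
      ≤ (N : ℝ) ^ 2 * (8 * n * Real.exp (-(2 * δ ^ 2 / (∑ i, σ i) * b))) := by
  have hS : 0 < ∑ i, σ i := hpq.trans_le (weightedForm_le_sum_of_mem_stdSimplex hp hq hσ)
  set E := 8 * n * Real.exp (-(2 * δ ^ 2 / (∑ i, σ i) * b))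
  let A : ℕ × ℕ → Set Ω := fun r => {ω | b ≤ halfLength r.1 r.2 * ∑ i, σ i ∧
    ¬ BlocksClose p q δ (fun s => X s ω) r.1 r.2}
  have hA : ∀ r, μ.real (A r) ≤ E := fun r => by
    -- Either M ≥ b/S, which turns the Hoeffding exponent in M into one in b, or the pair
    -- contributes nothing.
    by_cases hr : b ≤ halfLength r.1 r.2 * ∑ i, σ i
    · refine (measureReal_mono fun ω hω => hω.2).trans
        ((h.measureReal_not_blocksClose_le hδ r.1 r.2).trans ?_)
      refine mul_le_mul_of_nonneg_left (Real.exp_le_exp.2 (neg_le_neg ?_)) (by positivity)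
      rw [div_mul_eq_mul_div, div_le_iff₀ hS]
      nlinarith [sq_nonneg δ]
    · have : A r = ∅ := Set.eq_empty_of_forall_notMem fun ω hω => hr hω.1
      rw [this]
      simp only [measureReal_empty]
      positivity
  have hsub : {ω | scanTime σ b (fun s => X s ω) < N}
      ⊆ ⋃ r ∈ Finset.range N ×ˢ Finset.range N, A r := by
    intro ω hω
    by_contra hc
    refine absurd (le_scanTime_of_blocksClose hp hq hσ hpq hδ hN fun t ht k hk hb => ?_)
      (not_le.2 hω)
    by_contra hcl
    refine hc (Set.mem_iUnion₂.2 ⟨(t, k), ?_, hb, hcl⟩)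
    simp only [Finset.mem_product, Finset.mem_range]
    omega
  calc _ ≤ ∑ r ∈ Finset.range N ×ˢ Finset.range N, μ.real (A r) :=
        (measureReal_mono hsub (measure_ne_top _ _)).trans (measureReal_biUnion_finset_le _ _)
    _ ≤ ∑ r ∈ Finset.range N ×ˢ Finset.range N, E := Finset.sum_le_sum fun r _ => hA r
    _ = _ := by
        rw [Finset.sum_const, Finset.card_product, Finset.card_range, nsmul_eq_mul]
        push_cast
        ring

lemma eventually_le_expectedTime_scanTime (h : ChangeAtZero μ p q X)
    (hp : p ∈ stdSimplex ℝ (Fin n)) (hq : q ∈ stdSimplex ℝ (Fin n)) (hσ : ∀ i, 0 ≤ σ i)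
    (hpq : 0 < weightedForm σ (p - q) (p - q)) {c : ℝ}
    (hc : c < 2 / weightedForm σ (p - q) (p - q)) :
    ∀ᶠ b : ℝ in atTop, ENNReal.ofReal (c * b) ≤ expectedTime μ X (scanTime σ b) := by
  have hS : 0 < ∑ i, σ i := hpq.trans_le (weightedForm_le_sum_of_mem_stdSimplex hp hq hσ)
  set Δ := weightedForm σ (p - q) (p - q)
  set S := ∑ i, σ i
  -- The slope c₁ defines N, and c₂ > c₁ leaves room for rounding N up; the gap from c₂ to 2/Δ pays
  -- for δ. The maximum with 0 allows negative c.
  obtain ⟨c₁, hc₁, hc₁'⟩ := exists_between (max_lt hc (by positivity : 0 < 2 / Δ))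
  have hc₁0 : 0 < c₁ := (le_max_right _ _).trans_lt hc₁
  obtain ⟨c₂, hc₂, hc₂'⟩ := exists_between hc₁'
  have hc₂0 : 0 < c₂ := hc₁0.trans hc₂
  have hΔ : Δ < 2 / c₂ := by
    rw [lt_div_iff₀ hpq] at hc₂'
    rw [lt_div_iff₀ hc₂0]
    linarith
  obtain ⟨δ, hδ, hδ'⟩ : ∃ δ : ℝ, 0 < δ ∧ Δ + 4 * δ * S = 2 / c₂ := by
    refine ⟨(2 / c₂ - Δ) / (4 * S), div_pos (by linarith) (by positivity), ?_⟩
    field_simp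
    ring
  set a := 2 * δ ^ 2 / S
  have ha : 0 < a := by positivity
  have hlim : Tendsto (fun b : ℝ => (c₁ * b + 1) ^ 2 * (8 * n * Real.exp (-(a * b)))) atTop
      (𝓝 0) := by
    have h2 := Real.tendsto_pow_mul_exp_neg_atTop_nhds_zero 2
    have hab : Tendsto (fun b : ℝ => a * b) atTop atTop := tendsto_id.const_mul_atTop ha
    have h3 := (h2.comp hab).const_mul (8 * n * (c₁ + 1) ^ 2 / a ^ 2)
    rw [mul_zero] at h3
    refine squeeze_zero' ?_ ?_ h3
    · filter_upwards with b
      positivity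
    · filter_upwards [eventually_ge_atTop 1] with b hb
      have : (c₁ * b + 1) ^ 2 ≤ ((c₁ + 1) * b) ^ 2 := by
        refine pow_le_pow_left₀ (by positivity) (by linarith) 2
      calc _ ≤ ((c₁ + 1) * b) ^ 2 * (8 * n * Real.exp (-(a * b))) :=
            mul_le_mul_of_nonneg_right this (by positivity)
        _ = _ := by
            simp only [Function.comp]
            field_simp
  -- With probability at least c⁺/c₁ of reaching N ≥ c₁b, the mean is at least c⁺b.
  have hpos : 0 < 1 - max c 0 / c₁ := by
    rw [sub_pos, div_lt_one hc₁0]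
    exact hc₁
  filter_upwards [hlim.eventually_lt_const hpos, eventually_gt_atTop (1 / (c₂ - c₁)),
    eventually_gt_atTop 0] with b hb1 hb2 hb0
  set N := ⌈c₁ * b⌉₊
  have hN1 : c₁ * b ≤ N := Nat.le_ceil _
  have hN2 : (N : ℝ) < c₁ * b + 1 := Nat.ceil_lt_add_one (by positivity)
  have hN3 : (N : ℝ) < c₂ * b := by
    rw [div_lt_iff₀ (by linarith)] at hb2
    nlinarith
  have hNb : N / 2 * (Δ + 4 * δ * S) < b := by
    rw [hδ']
    calc (N : ℝ) / 2 * (2 / c₂) = N / c₂ := by ring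
      _ < b := by rw [div_lt_iff₀ hc₂0]; linarith
  have hbad := h.measureReal_scanTime_lt_le hp hq hσ hpq hδ hNb
  set B := {ω | scanTime σ b (fun s => X s ω) < N}
  have hbad : μ.real B ≤ 1 - max c 0 / c₁ := by
    refine hbad.trans (le_trans ?_ hb1.le)
    exact mul_le_mul_of_nonneg_right (pow_le_pow_left₀ (by positivity) hN2.le 2) (by positivity)
  -- Measurability of `B` is not established, so the complement of its measurable hull serves as the
  -- good event.
  obtain ⟨G, hGB, hGm, hGμ⟩ : ∃ G : Set Ω, Disjoint G B ∧ MeasurableSet G ∧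
      max c 0 / c₁ ≤ μ.real G := by
    refine ⟨(toMeasurable μ B)ᶜ, ?_, (measurableSet_toMeasurable μ B).compl, ?_⟩
    · exact Set.disjoint_left.2 fun ω hω hB => hω (subset_toMeasurable μ B hB)
    · rw [probReal_compl_eq_one_sub (measurableSet_toMeasurable μ B)]
      simp only [measureReal_def, measure_toMeasurable] at hbad ⊢
      linarith
  calc ENNReal.ofReal (c * b) ≤ ENNReal.ofReal (N * μ.real G) := by
        refine ENNReal.ofReal_le_ofReal ?_
        calc c * b ≤ max c 0 * b := mul_le_mul_of_nonneg_right (le_max_left _ _) hb0.le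
          _ = (c₁ * b) * (max c 0 / c₁) := by field_simp
          _ ≤ N * μ.real G := mul_le_mul hN1 hGμ (by positivity) (by positivity)
    _ = ∫⁻ ω, G.indicator (fun _ => (N : ℝ≥0∞)) ω ∂μ := by
        rw [lintegral_indicator_const hGm, ENNReal.ofReal_mul (by positivity)]
        simp
    _ ≤ expectedTime μ X (scanTime σ b) := by
        refine lintegral_mono fun ω => ?_
        by_cases hω : ω ∈ G
        · rw [Set.indicator_of_mem hω]
          have : (N : ℕ∞) ≤ scanTime σ b (fun s => X s ω) :=
            not_lt.1 fun hB => Set.disjoint_left.1 hGB hω hB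
          simpa using ENat.toENNReal_le.2 this
        · rw [Set.indicator_of_notMem hω]
          exact zero_le

end ChangeAtZero

end LowerBound

/-! ### Asymptotics and waiting times in [0, ∞]. -/

/-- A family of extended nonnegative reals which is eventually between `c * b` and `c' * b` for all
`c < d < c'` is asymptotic to `d * b`. -/
lemma tendsto_div_ofReal_of_eventually_between {f : ℝ → ℝ≥0∞} {d : ℝ} (hd : 0 < d)
    (hl : ∀ c < d, ∀ᶠ b in atTop, ENNReal.ofReal (c * b) ≤ f b)
    (hu : ∀ c, d < c → ∀ᶠ b in atTop, f b ≤ ENNReal.ofReal (c * b)) :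
    Tendsto (fun b => f b / ENNReal.ofReal (d * b)) atTop (𝓝 1) := by
  have key : ∀ r b : ℝ, 0 < b →
      ENNReal.ofReal (r * d * b) / ENNReal.ofReal (d * b) = ENNReal.ofReal r := fun r b hb => by
    rw [← ENNReal.ofReal_div_of_pos (by positivity)]
    congr 1
    field_simp
  refine tendsto_order.2 ⟨fun r hr => ?_, fun r hr => ?_⟩
  · obtain ⟨s, hrs, hs1⟩ := exists_between hr
    have hs : s ≠ ∞ := (hs1.trans ENNReal.one_lt_top).ne
    have hs1' : s.toReal < 1 := by
      simpa using (ENNReal.toReal_lt_toReal hs ENNReal.one_ne_top).2 hs1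
    filter_upwards [hl (s.toReal * d) (by nlinarith), eventually_gt_atTop 0] with b hb hb0
    refine hrs.trans_le ?_
    calc s = ENNReal.ofReal s.toReal := (ENNReal.ofReal_toReal hs).symm
      _ = _ := (key _ b hb0).symm
      _ ≤ _ := ENNReal.div_le_div_right hb _
  · obtain ⟨s, hs1, hrs⟩ := exists_between hr
    have hs : s ≠ ∞ := (hrs.trans_le le_top).ne
    have hs1' : 1 < s.toReal := by
      simpa using (ENNReal.toReal_lt_toReal ENNReal.one_ne_top hs).2 hs1
    filter_upwards [hu (s.toReal * d) (by nlinarith), eventually_gt_atTop 0] with b hb hb0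
    refine lt_of_le_of_lt ?_ hrs
    calc _ ≤ _ := ENNReal.div_le_div_right hb _
      _ = _ := key _ b hb0
      _ = s := ENNReal.ofReal_toReal hs

/-- Pointwise form of the tail-sum bound: with `g m` the indicator of failure at the m-th attempt,
the failures before the first success are counted by the sum, which is infinite if no attempt
succeeds. -/
lemma le_add_mul_tsum_of_forall {v a L : ℝ≥0∞} (hL : L ≠ 0) {g : ℕ → ℝ≥0∞}
    (h : ∀ m : ℕ, v ≤ a + L * m ∨ g m = 1) : v ≤ a + L * ∑' i, g i := by
  classical
  by_cases hg : ∀ i, g i = 1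
  · have : ∑' i, g i = ∞ := by
      simp only [hg]
      exact ENNReal.tsum_const_eq_top_of_ne_zero one_ne_zero
    rw [this, ENNReal.mul_top hL, add_top]
    exact le_top
  · push Not at hg
    set m := Nat.find hg
    have h1 : ∀ i ∈ Finset.range m, g i = 1 := fun i hi =>
      not_not.1 (Nat.find_min hg (Finset.mem_range.1 hi))
    have h2 : (m : ℝ≥0∞) ≤ ∑' i, g i := by
      refine le_trans (le_of_eq ?_) (ENNReal.sum_le_tsum (Finset.range m))
      rw [Finset.sum_congr rfl h1]
      simp
    exact ((h m).resolve_right (Nat.find_spec hg)).trans (by gcongr)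

/-! ### Upper bound for the full scan. -/

section UpperBound

variable {n : ℕ} {p q σ : Fin n → ℝ} {Ω : Type*} [MeasurableSpace Ω] {X : ℤ → Ω → Fin n}
  {μ : Measure Ω} [IsProbabilityMeasure μ]

lemma exists_pos_sub_four_mul_eq {Δ S c : ℝ} (hS : 0 < S) (hΔ : 0 < Δ) (hc : 2 / Δ < c) :
    ∃ δ : ℝ, 0 < δ ∧ Δ - 4 * δ * S = 2 / c := by
  have hc0 : 0 < c := (by positivity : 0 < 2 / Δ).trans hc
  have : 2 / c < Δ := by
    rw [div_lt_iff₀ hΔ] at hc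
    rw [div_lt_iff₀ hc0]
    linarith
  refine ⟨(Δ - 2 / c) / (4 * S), div_pos (by linarith) (by positivity), ?_⟩
  field_simp
  ring

lemma measurableSet_detectionStat_lt {t k : ℕ} (hX : ∀ s : ℤ, s ≤ t → Measurable (X s))
    (hkt : k ≤ t) (b : ℝ) : MeasurableSet {ω | detectionStat σ (fun s => X s ω) t k < b} :=
  measurableSet_lt (measurable_detectionStat hX hkt) measurable_const

namespace ChangeAtZero

/-- The probability that the statistic at the true change-point has not crossed `b` by the time
`t ≥ c * b` is exponentially small, if `c > 2 / Δ`. -/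
lemma exists_measureReal_detectionStat_zero_lt_le
    (hp : p ∈ stdSimplex ℝ (Fin n)) (hq : q ∈ stdSimplex ℝ (Fin n)) (hσ : ∀ i, 0 ≤ σ i)
    (hpq : 0 < weightedForm σ (p - q) (p - q)) {c : ℝ}
    (hc : 2 / weightedForm σ (p - q) (p - q) < c) :
    ∃ a : ℝ, 0 < a ∧ ∀ {Ω : Type u} [MeasurableSpace Ω] {μ : Measure Ω} [IsProbabilityMeasure μ]
      {X : ℤ → Ω → Fin n}, ChangeAtZero μ p q X → ∀ (b : ℝ) (t : ℕ), c * b ≤ t →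
      μ.real {ω | detectionStat σ (fun s => X s ω) t 0 < b} ≤ 8 * n * Real.exp (-(a * t)) := by
  have hS : 0 < ∑ i, σ i := hpq.trans_le (weightedForm_le_sum_of_mem_stdSimplex hp hq hσ)
  have hc0 : 0 < c := (by positivity : 0 < 2 / weightedForm σ (p - q) (p - q)).trans hc
  obtain ⟨δ, hδ, hδ'⟩ := exists_pos_sub_four_mul_eq hS hpq hc
  -- The rate is fixed before the probability space, so the constant C built from it depends only on
  -- `p`, `q`, `σ`.
  refine ⟨δ ^ 2, by positivity, fun h b t hbt => ?_⟩
  refine h.measureReal_detectionStat_zero_lt_le hp hq hσ hδ (by rw [hδ']; positivity) ?_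
  rw [hδ']
  calc b ≤ t / c := by rw [le_div_iff₀ hc0]; linarith
    _ = _ := by ring

/-- After N ≈ c₁b the misses at k = 0 are dominated by a geometric series, so the mean exceeds N by
at most a constant `K`, absorbed by the gap c - c₁. -/
lemma eventually_expectedTime_scanTime_le (h : ChangeAtZero μ p q X)
    (hp : p ∈ stdSimplex ℝ (Fin n)) (hq : q ∈ stdSimplex ℝ (Fin n)) (hσ : ∀ i, 0 ≤ σ i)
    (hpq : 0 < weightedForm σ (p - q) (p - q)) {c : ℝ}
    (hc : 2 / weightedForm σ (p - q) (p - q) < c) :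
    ∀ᶠ b : ℝ in atTop, expectedTime μ X (scanTime σ b) ≤ ENNReal.ofReal (c * b) := by
  obtain ⟨c₁, hc₁, hc₁'⟩ := exists_between hc
  have hc₁0 : 0 < c₁ := (by positivity : 0 < 2 / weightedForm σ (p - q) (p - q)).trans hc₁
  obtain ⟨a, ha, hA⟩ := exists_measureReal_detectionStat_zero_lt_le hp hq hσ hpq hc₁
  set r := Real.exp (-a)
  have hr0 : 0 < r := Real.exp_pos _
  have hr1 : r < 1 := by simpa [r] using ha
  set K := 8 * n * (1 - r)⁻¹
  filter_upwards [eventually_gt_atTop ((1 + K) / (c - c₁)), eventually_gt_atTop 0] with b hb hb0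
  set N := ⌈c₁ * b⌉₊
  have hN1 : c₁ * b ≤ N := Nat.le_ceil _
  have hN2 : (N : ℝ) < c₁ * b + 1 := Nat.ceil_lt_add_one (by positivity)
  let A : ℕ → Set Ω := fun t => {ω | detectionStat σ (fun s => X s ω) (N + t) 0 < b}
  have hAm : ∀ t, MeasurableSet (A t) := fun t =>
    measurableSet_detectionStat_lt (fun s _ => h.measurable s) (Nat.zero_le _) b
  have hAμ : ∀ t, μ (A t) ≤ ENNReal.ofReal (8 * n * r ^ t) := fun t => by
    rw [← ofReal_measureReal]
    refine ENNReal.ofReal_le_ofReal ((hA h b (N + t) ?_).trans ?_)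
    · push_cast
      linarith [(Nat.cast_nonneg t : (0 : ℝ) ≤ t)]
    · refine mul_le_mul_of_nonneg_left ?_ (by positivity)
      rw [← Real.exp_nat_mul]
      refine Real.exp_le_exp.2 ?_
      push_cast
      nlinarith [(Nat.cast_nonneg N : (0 : ℝ) ≤ N)]
  have hsum : ∑' t, μ (A t) ≤ ENNReal.ofReal K := by
    refine (ENNReal.tsum_le_tsum hAμ).trans (le_of_eq ?_)
    rw [← ENNReal.ofReal_tsum_of_nonneg (fun t => by positivity)
      ((summable_geometric_of_lt_one hr0.le hr1).mul_left _), tsum_mul_left,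
      tsum_geometric_of_lt_one hr0.le hr1]
  calc expectedTime μ X (scanTime σ b)
      ≤ ∫⁻ ω, ((N : ℝ≥0∞) + 1 * ∑' t, (A t).indicator 1 ω) ∂μ := by
        refine lintegral_mono fun ω => le_add_mul_tsum_of_forall one_ne_zero fun t => ?_
        by_cases hω : ω ∈ A t
        · right
          simp [hω]
        · left
          have h1 := ENat.toENNReal_le.2 (scanTime_le (Nat.zero_le (N + t)) (not_lt.1 hω))
          simpa using h1
    _ = N + ∑' t, μ (A t) := by
        simp only [one_mul]
        rw [lintegral_add_left measurable_const, lintegral_tsum fun t =>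
          (measurable_one.indicator (hAm t)).aemeasurable]
        simp [hAm]
    _ ≤ ENNReal.ofReal (c₁ * b + 1) + ENNReal.ofReal K := by
        gcongr
        rw [← ENNReal.ofReal_natCast]
        exact ENNReal.ofReal_le_ofReal hN2.le
    _ ≤ ENNReal.ofReal (c * b) := by
        have hK : 0 ≤ K := mul_nonneg (by positivity) (inv_nonneg.2 (by linarith))
        rw [← ENNReal.ofReal_add (by positivity) hK]
        refine ENNReal.ofReal_le_ofReal ?_
        rw [div_lt_iff₀ (by linarith)] at hb
        linarith

end ChangeAtZero

end UpperBound

/-! ### Accidental crossings and the waiting time for a pattern. -/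

section Pattern

variable {n : ℕ} {p q σ : Fin n → ℝ}

lemma empirical_eq_single {x : ℤ → Fin n} {s : ℤ} {M : ℕ} (hM : 0 < M) {i : Fin n}
    (hx : ∀ r < M, x (s + (r : ℤ)) = i) (a : Fin n) :
    empirical x s M a = if a = i then 1 else 0 := by
  have h : ∀ r ∈ Finset.range M, (if x (s + (r : ℤ)) = a then (1 : ℝ) else 0)
      = if a = i then 1 else 0 := fun r hr => by
    rw [hx r (Finset.mem_range.1 hr)]
    simp only [eq_comm]
  have : (M : ℝ) ≠ 0 := by positivity
  rw [empirical_eq_sum_ite, Finset.sum_congr rfl h, Finset.sum_const, Finset.card_range, nsmul_eq_mul,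
    mul_div_cancel_left₀ _ this]

/-- If the first two blocks contain only `i` and the last two only `j`, the statistic is at least
`M * σ i`. -/
lemma mul_le_detectionStat_of_pattern (hσ : ∀ i, 0 ≤ σ i) {i j : Fin n} (hij : i ≠ j) {M s : ℕ}
    (hM : 0 < M) {x : ℤ → Fin n}
    (hx : ∀ r < 4 * M, x ((s : ℤ) + (r : ℤ)) = if r < 2 * M then i else j) :
    M * σ i ≤ detectionStat σ x (s + 4 * M) (s + 2 * M) := by
  have hl : halfLength (s + 4 * M) (s + 2 * M) = M := by unfold halfLength; omega
  have hblock : ∀ (l : ℕ), l ≤ 3 * M → ∀ c, (∀ r < M, (if l + r < 2 * M then i else j) = c) →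
      ∀ a, empirical x ((s : ℤ) + l) M a = if a = c then 1 else 0 := fun l hl c hc =>
    empirical_eq_single hM fun r hr => by
      rw [add_assoc, ← Nat.cast_add, hx (l + r) (by omega), hc r hr]
  have h1 := hblock 0 (by omega) i fun r hr => if_pos (by omega)
  have h2 := hblock M (by omega) i fun r hr => if_pos (by omega)
  have h3 := hblock (2 * M) (by omega) j fun r hr => if_neg (by omega)
  have h4 := hblock (3 * M) (by omega) j fun r hr => if_neg (by omega)
  simp only [detectionStat, hl]
  refine mul_le_mul_of_nonneg_left ?_ (by positivity)
  rw [show ((s + 2 * M : ℕ) : ℤ) - 2 * (M : ℤ) = (s : ℤ) + (0 : ℕ) by push_cast; ring,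
    show ((s + 2 * M : ℕ) : ℤ) - (M : ℤ) = (s : ℤ) + M by push_cast; ring,
    show ((s + 2 * M : ℕ) : ℤ) + (M : ℤ) = (s : ℤ) + (3 * M : ℕ) by push_cast; ring,
    show ((s + 2 * M : ℕ) : ℤ) = (s : ℤ) + (2 * M : ℕ) by push_cast; ring]
  unfold weightedForm
  simp only [Pi.sub_apply, h1, h2, h3, h4]
  -- Both difference vectors equal eᵢ - eⱼ, so the summands are weighted squares and may be dropped
  -- except at `i`.
  refine le_trans (le_of_eq ?_) (Finset.single_le_sum (fun a _ => ?_) (Finset.mem_univ i))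
  · simp [hij]
  · rw [mul_assoc]
    exact mul_nonneg (hσ a) (mul_self_nonneg _)

variable {Ω : Type*} [mΩ : MeasurableSpace Ω] {X : ℤ → Ω → Fin n}

/-- The `σ`-algebra generated by the samples before time `s`. -/
abbrev samplesBefore (X : ℤ → Ω → Fin n) (s : ℤ) : MeasurableSpace Ω :=
  ⨆ t ∈ {t : ℤ | t < s}, MeasurableSpace.comap (X t) ⊤

/-- The `σ`-algebra generated by the samples from time `s` on. -/
abbrev samplesFrom (X : ℤ → Ω → Fin n) (s : ℤ) : MeasurableSpace Ω :=
  ⨆ t ∈ {t : ℤ | s ≤ t}, MeasurableSpace.comap (X t) ⊤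

omit mΩ in
lemma measurable_samplesBefore {s t : ℤ} (hts : t < s) : Measurable[samplesBefore X s] (X t) :=
  Measurable.mono (comap_measurable (X t))
    (le_iSup₂ (f := fun t (_ : t ∈ {t : ℤ | t < s}) => MeasurableSpace.comap (X t) ⊤) t hts) le_rfl

omit mΩ in
lemma measurable_samplesFrom {s t : ℤ} (hts : s ≤ t) : Measurable[samplesFrom X s] (X t) :=
  Measurable.mono (comap_measurable (X t))
    (le_iSup₂ (f := fun t (_ : t ∈ {t : ℤ | s ≤ t}) => MeasurableSpace.comap (X t) ⊤) t hts) le_rfl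

omit mΩ in
lemma samplesBefore_mono {s t : ℤ} (hst : s ≤ t) : samplesBefore X s ≤ samplesBefore X t :=
  biSup_mono fun _ h => lt_of_lt_of_le h hst

lemma measurableSet_exists_ne (s : ℤ) (L : ℕ) (pat : ℕ → Fin n)
    (hX : ∀ r < L, Measurable (X (s + (r : ℤ)))) :
    MeasurableSet {ω | ∃ r < L, X (s + (r : ℤ)) ω ≠ pat r} := by
  have : {ω | ∃ r < L, X (s + (r : ℤ)) ω ≠ pat r}
      = ⋃ r ∈ Finset.range L, X (s + (r : ℤ)) ⁻¹' {pat r}ᶜ := by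
    ext ω
    simp
  rw [this]
  exact Finset.measurableSet_biUnion _ fun r hr =>
    hX r (Finset.mem_range.1 hr) (measurableSet_singleton _).compl

variable {μ : Measure Ω}

namespace ChangeAtZero

lemma indep_samplesBefore_samplesFrom (h : ChangeAtZero μ p q X) (s : ℤ) :
    Indep (samplesBefore X s) (samplesFrom X s) μ :=
  indep_iSup_of_disjoint (fun t => (h.measurable t).comap_le) h.indep.iIndep
    (Set.disjoint_left.2 fun t (h1 : t < s) (h2 : s ≤ t) => not_lt.2 h2 h1)

variable [IsProbabilityMeasure μ]

lemma measureReal_exists_ne_le (h : ChangeAtZero μ p q X) {s : ℤ} (hs : 0 ≤ s) {L : ℕ}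
    {pat : ℕ → Fin n} {w : ℝ} (hw0 : 0 ≤ w) (hw : ∀ r < L, w ≤ q (pat r)) :
    μ.real {ω | ∃ r < L, X (s + (r : ℤ)) ω ≠ pat r} ≤ 1 - w ^ L := by
  have hm := measurableSet_exists_ne s L pat fun r _ => h.measurable _
  have h1 : iIndepFun (fun (r : ℕ) => X (s + (r : ℤ))) μ :=
    h.indep.precomp (g := fun j : ℕ => s + (j : ℤ)) fun i j hij => by simpa using hij
  have h2 := h1.meas_biInter (S := Finset.range L) (s := fun r => X (s + (r : ℤ)) ⁻¹' {pat r})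
    fun r _ => ⟨_, measurableSet_singleton _, rfl⟩
  have hc : {ω | ∃ r < L, X (s + (r : ℤ)) ω ≠ pat r}ᶜ
      = ⋂ r ∈ Finset.range L, X (s + (r : ℤ)) ⁻¹' {pat r} := by
    ext ω
    simp
  rw [← compl_compl {ω | ∃ r < L, X (s + (r : ℤ)) ω ≠ pat r}, probReal_compl_eq_one_sub hm.compl,
    hc, measureReal_def, h2, ENNReal.toReal_prod]
  refine sub_le_sub_left ?_ 1
  calc w ^ L = ∏ r ∈ Finset.range L, w := by simp
    _ ≤ _ := Finset.prod_le_prod (fun _ _ => hw0) fun r hr =>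
        (hw r (Finset.mem_range.1 hr)).trans (h.post _ (by positivity) (pat r)).ge

/-- The probability that an event of the past happens and that after it the first `j` of the
consecutive blocks of length `L` all fail to show a given pattern. -/
lemma measureReal_inter_forall_exists_ne_le (h : ChangeAtZero μ p q X) {s : ℤ} (hs : 0 ≤ s) {L : ℕ}
    {pat : ℕ → Fin n} {w : ℝ} (hw0 : 0 ≤ w) (hw1 : w ≤ 1) (hw : ∀ r < L, w ≤ q (pat r)) {A : Set Ω}
    (hA : MeasurableSet[samplesBefore X s] A) (j : ℕ) :
    MeasurableSet[samplesBefore X (s + (j * L : ℕ))]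
      (A ∩ {ω | ∀ i < j, ∃ r < L, X (s + (i * L : ℕ) + (r : ℤ)) ω ≠ pat r}) ∧
    μ.real (A ∩ {ω | ∀ i < j, ∃ r < L, X (s + (i * L : ℕ) + (r : ℤ)) ω ≠ pat r})
      ≤ μ.real A * (1 - w ^ L) ^ j := by
  -- Measurability with respect to the past is carried along because the next factor comes from
  -- independence of past and future.
  induction j with
  | zero =>
    rw [zero_mul, Nat.cast_zero, add_zero]
    simpa using hA
  | succ j ih =>
    set D := A ∩ {ω | ∀ i < j, ∃ r < L, X (s + (i * L : ℕ) + (r : ℤ)) ω ≠ pat r}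
    set F := {ω | ∃ r < L, X (s + (j * L : ℕ) + (r : ℤ)) ω ≠ pat r}
    have hD : A ∩ {ω | ∀ i < j + 1, ∃ r < L, X (s + (i * L : ℕ) + (r : ℤ)) ω ≠ pat r}
        = D ∩ F := by
      ext ω
      simp only [D, F, Set.mem_inter_iff, Set.mem_ofPred_eq, Nat.forall_lt_succ_right, and_assoc]
    have hF1 : MeasurableSet[samplesFrom X (s + (j * L : ℕ))] F :=
      @measurableSet_exists_ne n Ω (samplesFrom X (s + (j * L : ℕ))) X _ L pat
        fun r _ => measurable_samplesFrom (by omega)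
    have hF2 : MeasurableSet[samplesBefore X (s + ((j + 1) * L : ℕ))] F :=
      @measurableSet_exists_ne n Ω (samplesBefore X (s + ((j + 1) * L : ℕ))) X _ L pat
        fun r hr => measurable_samplesBefore (by
          rw [add_one_mul]
          push_cast
          omega)
    rw [hD]
    refine ⟨MeasurableSet.inter (samplesBefore_mono ?_ _ ih.1) hF2, ?_⟩
    · rw [add_one_mul]
      push_cast
      omega
    · have hind := (Indep_iff _ _ μ).1 (h.indep_samplesBefore_samplesFrom _) D F ih.1 hF1
      have hp := h.measureReal_exists_ne_le (s := s + (j * L : ℕ)) (by positivity) hw0 hw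
      have hw2 : w ^ L ≤ 1 := pow_le_one₀ hw0 hw1
      rw [measureReal_def, hind, ENNReal.toReal_mul, pow_succ, ← mul_assoc]
      exact mul_le_mul ih.2 hp measureReal_nonneg
        (mul_nonneg measureReal_nonneg (pow_nonneg (by linarith) _))

end ChangeAtZero

end Pattern

/-! ### Upper bound for the window-limited scan. -/

section WindowUpperBound

variable {n : ℕ} {p q σ : Fin n → ℝ} {Ω : Type*} [MeasurableSpace Ω] {X : ℤ → Ω → Fin n}
  {μ : Measure Ω} [IsProbabilityMeasure μ]

namespace ChangeAtZero

/-- The window-limited procedure stops by time `N₁`, or else by time `N₂`, or else at the end of the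
first of the consecutive blocks of `4 * M` samples which consists of `2 * M` samples `i` followed by
`2 * M` samples `j`. -/
lemma expectedTime_windowScanTime_le (h : ChangeAtZero μ p q X) (hσ : ∀ i, 0 ≤ σ i) {b : ℝ}
    {m₀ m₁ N₁ N₂ M : ℕ} (hN₁ : m₀ ≤ N₁ ∧ N₁ ≤ m₁) (hN₂ : m₀ ≤ N₂ ∧ N₂ ≤ m₁)
    (hM : m₀ ≤ 2 * M ∧ 2 * M ≤ m₁) (hM0 : 0 < M) {i j : Fin n} (hij : i ≠ j) (hb : b ≤ M * σ i)
    {w : ℝ} (hw0 : 0 < w) (hw1 : w ≤ 1) (hwi : w ≤ q i) (hwj : w ≤ q j) :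
    expectedTime μ X (windowScanTime σ m₀ m₁ b) ≤ ENNReal.ofReal (N₁ + (N₂ + 1) *
      (μ.real {ω | detectionStat σ (fun s => X s ω) N₁ 0 < b}
        + μ.real {ω | detectionStat σ (fun s => X s ω) N₂ 0 < b})
      + 4 * M * (μ.real {ω | detectionStat σ (fun s => X s ω) N₂ 0 < b} / w ^ (4 * M))) := by
  set A₁ := {ω | detectionStat σ (fun s => X s ω) N₁ 0 < b}
  set A₂ := {ω | detectionStat σ (fun s => X s ω) N₂ 0 < b}
  let pat : ℕ → Fin n := fun r => if r < 2 * M then i else j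
  let D : ℕ → Set Ω := fun l => A₂ ∩ {ω | ∀ m < l, ∃ r < 4 * M,
    X (((N₂ + 1 : ℕ) : ℤ) + (m * (4 * M) : ℕ) + (r : ℤ)) ω ≠ pat r}
  have hw : ∀ r < 4 * M, w ≤ q (pat r) := fun r _ => by
    simp only [pat]
    split_ifs <;> assumption
  have hA₁ : MeasurableSet A₁ :=
    measurableSet_detectionStat_lt (fun s _ => h.measurable s) (Nat.zero_le _) b
  have hA₂ : MeasurableSet A₂ :=
    measurableSet_detectionStat_lt (fun s _ => h.measurable s) (Nat.zero_le _) b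
  -- The miss at N₂ involves samples up to time N₂ only, and the pattern blocks start at N₂ + 1.
  have hA₂' : MeasurableSet[samplesBefore X ((N₂ + 1 : ℕ) : ℤ)] A₂ :=
    @measurableSet_detectionStat_lt n σ Ω (samplesBefore X ((N₂ + 1 : ℕ) : ℤ)) X N₂ 0
      (fun s hs => measurable_samplesBefore (by omega)) (Nat.zero_le _) b
  have hD := fun l => h.measureReal_inter_forall_exists_ne_le (by positivity) hw0.le hw1 hw hA₂' l
  have hDm : ∀ l, MeasurableSet (D l) := fun l =>
    iSup₂_le (fun t _ => (h.measurable t).comap_le) _ (hD l).1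
  have hwM : 0 < w ^ (4 * M) := by positivity
  have hwM1 : w ^ (4 * M) ≤ 1 := pow_le_one₀ hw0.le hw1
  have hDμ : ∑' l, μ (D l) ≤ ENNReal.ofReal (μ.real A₂ / w ^ (4 * M)) := by
    have h1 : ∀ l, μ (D l) ≤ ENNReal.ofReal (μ.real A₂ * (1 - w ^ (4 * M)) ^ l) := fun l => by
      rw [← ofReal_measureReal]
      exact ENNReal.ofReal_le_ofReal (hD l).2
    refine (ENNReal.tsum_le_tsum h1).trans (le_of_eq ?_)
    rw [← ENNReal.ofReal_tsum_of_nonneg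
      (fun l => mul_nonneg measureReal_nonneg (pow_nonneg (by linarith) _))
      ((summable_geometric_of_lt_one (by linarith) (by linarith)).mul_left _), tsum_mul_left,
      tsum_geometric_of_lt_one (by linarith) (by linarith), sub_sub_cancel, div_eq_mul_inv]
  have hpoint : ∀ ω, ((windowScanTime σ m₀ m₁ b (fun s => X s ω) : ℕ∞) : ℝ≥0∞)
      ≤ ((N₁ : ℝ≥0∞) + (N₂ + 1 : ℕ) * (A₁.indicator 1 ω + A₂.indicator 1 ω))
        + (4 * M : ℕ) * ∑' l, (D l).indicator 1 ω := by
    intro ω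
    by_cases h₁ : ω ∈ A₁
    · by_cases h₂ : ω ∈ A₂
      · refine le_add_mul_tsum_of_forall (by simp; omega) fun l => ?_
        by_cases hl : ω ∈ D l
        · right
          simp [hl]
        left
        obtain ⟨m, hm, hpat⟩ : ∃ m < l, ∀ r < 4 * M,
            X (((N₂ + 1 : ℕ) : ℤ) + (m * (4 * M) : ℕ) + (r : ℤ)) ω = pat r := by
          by_contra! hc
          exact hl ⟨h₂, hc⟩
        have hstat := mul_le_detectionStat_of_pattern hσ hij hM0 (s := N₂ + 1 + m * (4 * M))
          (x := fun s => X s ω) fun r hr => by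
            refine Eq.trans ?_ (hpat r hr)
            push_cast
            rfl
        have hT := windowScanTime_le (by omega) (by omega) (by omega) (hb.trans hstat)
          (m₀ := m₀) (m₁ := m₁)
        refine (ENat.toENNReal_le.2 hT).trans ?_
        -- On both misses the two indicators supply 2(N₂ + 1), which covers the start of the blocks;
        -- m + 1 ≤ l covers the rest.
        have hml : N₂ + 1 + m * (4 * M) + 4 * M ≤ N₁ + (N₂ + 1) * (1 + 1) + 4 * M * l := by
          nlinarith
        simp only [h₁, h₂, Set.indicator_of_mem, Pi.one_apply]
        exact_mod_cast hml
      · have hT := windowScanTime_le (m₀ := m₀) (m₁ := m₁) (Nat.zero_le N₂) (by omega) (by omega)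
          (not_lt.1 h₂)
        refine (ENat.toENNReal_le.2 hT).trans (le_add_right (le_add_left ?_))
        simp [h₁, h₂]
    · have hT := windowScanTime_le (m₀ := m₀) (m₁ := m₁) (Nat.zero_le N₁) (by omega) (by omega)
        (not_lt.1 h₁)
      exact (ENat.toENNReal_le.2 hT).trans (le_add_right (le_add_right (by simp)))
  calc expectedTime μ X (windowScanTime σ m₀ m₁ b)
      ≤ ∫⁻ ω, (((N₁ : ℝ≥0∞) + (N₂ + 1 : ℕ) * (A₁.indicator 1 ω + A₂.indicator 1 ω))
        + (4 * M : ℕ) * ∑' l, (D l).indicator 1 ω) ∂μ := lintegral_mono hpoint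
    _ = (N₁ : ℝ≥0∞) + (N₂ + 1 : ℕ) * (μ A₁ + μ A₂) + (4 * M : ℕ) * ∑' l, μ (D l) := by
        have i₁ : Measurable (A₁.indicator (1 : Ω → ℝ≥0∞)) := measurable_one.indicator hA₁
        have i₂ : Measurable (A₂.indicator (1 : Ω → ℝ≥0∞)) := measurable_one.indicator hA₂
        have iD : ∀ l, Measurable ((D l).indicator (1 : Ω → ℝ≥0∞)) := fun l =>
          measurable_one.indicator (hDm l)
        rw [lintegral_add_left (by fun_prop), lintegral_add_left (by fun_prop),
          lintegral_const_mul _ (by fun_prop), lintegral_add_left i₁,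
          lintegral_const_mul _ (Measurable.tsum iD),
          lintegral_tsum fun l => (iD l).aemeasurable]
        simp [hA₁, hA₂, hDm]
    _ ≤ (N₁ : ℝ≥0∞) + (N₂ + 1 : ℕ) * (μ A₁ + μ A₂)
        + (4 * M : ℕ) * ENNReal.ofReal (μ.real A₂ / w ^ (4 * M)) := by gcongr
    _ = _ := by
        rw [ENNReal.ofReal_add (by positivity) (by positivity),
          ENNReal.ofReal_add (p := (N₁ : ℝ)) (by positivity) (by positivity),
          ENNReal.ofReal_mul (p := 4 * (M : ℝ)) (by positivity),
          ENNReal.ofReal_mul (p := (N₂ : ℝ) + 1) (by positivity),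
          ENNReal.ofReal_add (p := μ.real A₁) (by positivity) (by positivity), ofReal_measureReal,
          ofReal_measureReal, ENNReal.ofReal_natCast, ← ENNReal.ofReal_natCast (N₂ + 1),
          ← ENNReal.ofReal_natCast (4 * M)]
        push_cast
        rfl

end ChangeAtZero

lemma mul_exp_neg_mul_le {a x : ℝ} (ha : 0 < a) : x * Real.exp (-(a * x)) ≤ a⁻¹ := by
  have h := Real.add_one_le_exp (a * x)
  rw [Real.exp_neg, ← div_eq_mul_inv, div_le_iff₀ (Real.exp_pos _), inv_mul_eq_div, le_div_iff₀ ha]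
  linarith

/-- A time linear in b, weighted by an exponentially small probability, costs O(1). -/
lemma mul_le_of_le_mul_exp_neg {a b x y D K : ℝ} (ha : 0 < a) (hb : 0 ≤ b) (hD : 0 ≤ D)
    (hK : 0 ≤ K) (hx : x ≤ D * b) (hy0 : 0 ≤ y) (hy : y ≤ K * Real.exp (-(a * b))) :
    x * y ≤ D * (K * a⁻¹) :=
  calc x * y ≤ (D * b) * (K * Real.exp (-(a * b))) := mul_le_mul hx hy hy0 (by positivity)
    _ = D * (K * (b * Real.exp (-(a * b)))) := by ring
    _ ≤ D * (K * a⁻¹) := mul_le_mul_of_nonneg_left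
        (mul_le_mul_of_nonneg_left (mul_exp_neg_mul_le ha) hK) hD

lemma exists_ne_pos_of_lt_one (hq : q ∈ stdSimplex ℝ (Fin n)) {i : Fin n} (hi : q i < 1) :
    ∃ j, i ≠ j ∧ 0 < q j := by
  by_contra! hc
  have h0 : ∀ j, j ≠ i → q j = 0 := fun j hj => le_antisymm (hc j hj.symm) (hq.1 j)
  have h1 := hq.2
  rw [Finset.sum_eq_single i (fun j _ hj => h0 j hj) (by simp)] at h1
  linarith

theorem exists_eventually_expectedTime_windowScanTime_le
    (hp : p ∈ stdSimplex ℝ (Fin n)) (hq : q ∈ stdSimplex ℝ (Fin n)) (hσ : ∀ i, 0 ≤ σ i)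
    (hpq : 0 < weightedForm σ (p - q) (p - q)) {i : Fin n} (hσi : 0 < σ i) (hqi : 0 < q i)
    (hqi1 : q i < 1) :
    ∃ C : ℝ, 2 / weightedForm σ (p - q) (p - q) < C ∧
      ∀ (m₀ : ℕ) (m₁ : ℝ → ℕ), (∀ᶠ b in atTop, C * b ≤ (m₁ b : ℝ)) →
        ∀ (Ω : Type u) [MeasurableSpace Ω] (μ : Measure Ω) [IsProbabilityMeasure μ]
          (X : ℤ → Ω → Fin n), ChangeAtZero μ p q X →
        ∀ c, 2 / weightedForm σ (p - q) (p - q) < c →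
          ∀ᶠ b in atTop, expectedTime μ X (windowScanTime σ m₀ (m₁ b) b)
            ≤ ENNReal.ofReal (c * b) := by
  obtain ⟨j, hij, hqj⟩ := exists_ne_pos_of_lt_one hq hqi1
  set Δ := weightedForm σ (p - q) (p - q)
  have hΔ2 : 0 < 2 / Δ := by positivity
  have hΔ24 : 2 / Δ < 4 / Δ := by gcongr; norm_num
  -- The rate for the late check is taken at the fixed slope 4/Δ, since C must not depend on c.
  obtain ⟨a₀, ha₀, hA₀⟩ := ChangeAtZero.exists_measureReal_detectionStat_zero_lt_le hp hq hσ hpq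
    (c := 4 / Δ) hΔ24
  set w := min (q i) (q j)
  have hw0 : 0 < w := lt_min hqi hqj
  have hw1 : w ≤ 1 := (min_le_left _ _).trans hqi1.le
  obtain ⟨l, hl, hwl⟩ : ∃ l : ℝ, 0 ≤ l ∧ ∀ m : ℕ, (w ^ m)⁻¹ = Real.exp (m * l) := by
    refine ⟨-Real.log w, neg_nonneg.2 (Real.log_nonpos hw0.le hw1), fun m => ?_⟩
    rw [mul_neg, Real.exp_neg, Real.exp_nat_mul, Real.exp_log hw0]
  have h4Δ : 0 < 4 / Δ := by positivity
  obtain ⟨C, hC4, hCσ, hCa⟩ : ∃ C : ℝ, 4 / Δ + 1 ≤ C - 2 ∧ 2 / σ i + 2 ≤ C - 1 ∧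
      4 * l / σ i + 1 ≤ a₀ * C := by
    have h1 : 0 ≤ 2 / σ i := by positivity
    have h2 : 0 ≤ (4 * l / σ i + 1) / a₀ := by positivity
    refine ⟨4 / Δ + 2 / σ i + 3 + (4 * l / σ i + 1) / a₀, by linarith, by linarith, ?_⟩
    rw [mul_add, mul_div_cancel₀ _ ha₀.ne']
    have : 0 ≤ a₀ * (4 / Δ + 2 / σ i + 3) := by positivity
    linarith
  have hC0 : 0 < C := by linarith
  refine ⟨C, by linarith, fun m₀ m₁ hm₁ Ω _ μ _ X h c hc => ?_⟩
  -- Below c to leave room for the error terms, below 4/Δ so that N₁ ≤ m₁.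
  obtain ⟨c₁, hc₁, hc₁'⟩ := exists_between (lt_min hc hΔ24)
  have hc₁0 : 0 < c₁ := hΔ2.trans hc₁
  have hc₁c : c₁ < c := hc₁'.trans_le (min_le_left _ _)
  have hc₁Δ : c₁ < 4 / Δ := hc₁'.trans_le (min_le_right _ _)
  obtain ⟨a₁, ha₁, hA₁⟩ := ChangeAtZero.exists_measureReal_detectionStat_zero_lt_le hp hq hσ hpq hc₁
  obtain ⟨K₁, hK₁⟩ : ∃ K, K = (C + 1) * (8 * n * (a₁ * c₁)⁻¹) := ⟨_, rfl⟩
  obtain ⟨K₂, hK₂⟩ : ∃ K, K = (C + 1) * (8 * n * Real.exp a₀ * 1⁻¹) := ⟨_, rfl⟩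
  obtain ⟨K₃, hK₃⟩ : ∃ K, K = 4 * (1 / σ i + 1) * (8 * n * Real.exp (a₀ + 4 * l) * 1⁻¹) :=
    ⟨_, rfl⟩
  filter_upwards [hm₁, eventually_ge_atTop 1, eventually_gt_atTop ((1 + K₁ + K₂ + K₃) / (c - c₁)),
    eventually_ge_atTop (m₀ / c₁), eventually_ge_atTop ((m₀ : ℝ)),
    eventually_ge_atTop (m₀ * σ i)] with b hbm₁ hb1 hbK hbc₁ hbm₀ hbσ
  have hb0 : 0 < b := by linarith
  set N₁ := ⌈c₁ * b⌉₊
  set N₂ := ⌊C * b⌋₊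
  set M := ⌈b / σ i⌉₊
  have hN₁ : c₁ * b ≤ N₁ := Nat.le_ceil _
  have hN₁' : (N₁ : ℝ) < c₁ * b + 1 := Nat.ceil_lt_add_one (by positivity)
  have hN₂ : (N₂ : ℝ) ≤ C * b := Nat.floor_le (by positivity)
  have hN₂' : C * b < N₂ + 1 := Nat.lt_floor_add_one _
  have hM : b / σ i ≤ M := Nat.le_ceil _
  have hM' : (M : ℝ) < b / σ i + 1 := Nat.ceil_lt_add_one (by positivity)
  have hM0 : 0 < M := Nat.ceil_pos.2 (by positivity)
  have hbσM : b ≤ M * σ i := by rwa [div_le_iff₀ hσi] at hM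
  clear_value N₁ N₂ M
  have hCΔ := mul_le_mul_of_nonneg_right (by linarith : 4 / Δ + 1 ≤ C) hb0.le
  have hE := h.expectedTime_windowScanTime_le (σ := σ) (b := b) (m₀ := m₀) (m₁ := m₁ b) (N₁ := N₁)
    (N₂ := N₂) (M := M) hσ ?_ ?_ ?_ hM0 hij hbσM hw0 hw1 (min_le_left _ _) (min_le_right _ _)
  · have hP₁ := hA₁ h b N₁ hN₁
    have hP₂ := hA₀ h b N₂ (by linarith)
    set P₁ := μ.real {ω | detectionStat σ (fun s => X s ω) N₁ 0 < b}
    set P₂ := μ.real {ω | detectionStat σ (fun s => X s ω) N₂ 0 < b}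
    have hP₁0 : 0 ≤ P₁ := measureReal_nonneg
    have hP₂0 : 0 ≤ P₂ := measureReal_nonneg
    clear_value P₁ P₂
    have hn : (0 : ℝ) ≤ 8 * n := by positivity
    have hCb : (N₂ : ℝ) + 1 ≤ (C + 1) * b := by linarith
    have e₁ : ((N₂ : ℝ) + 1) * P₁ ≤ K₁ := by
      rw [hK₁]
      refine mul_le_of_le_mul_exp_neg (mul_pos ha₁ hc₁0) hb0.le (by positivity) hn hCb hP₁0
        (hP₁.trans (mul_le_mul_of_nonneg_left (Real.exp_le_exp.2 (neg_le_neg ?_)) hn))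
      rw [mul_assoc]
      exact mul_le_mul_of_nonneg_left hN₁ ha₁.le
    -- Rounding Cb down to N₂ costs at most the factor exp(a₀).
    have hexp : -(a₀ * N₂) ≤ a₀ + -((4 * l / σ i + 1) * b) := by
      have h1 := mul_le_mul_of_nonneg_left hN₂'.le ha₀.le
      have h2 := mul_le_mul_of_nonneg_right hCa hb0.le
      linarith
    have e₂ : ((N₂ : ℝ) + 1) * P₂ ≤ K₂ := by
      rw [hK₂]
      refine mul_le_of_le_mul_exp_neg one_pos hb0.le (by positivity) (by positivity) hCb hP₂0
        (hP₂.trans ?_)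
      rw [mul_assoc (8 * (n : ℝ)), ← Real.exp_add]
      refine mul_le_mul_of_nonneg_left (Real.exp_le_exp.2 (hexp.trans ?_)) hn
      have : 0 ≤ 4 * l / σ i * b := by positivity
      linarith
    have e₃ : 4 * M * (P₂ / w ^ (4 * M)) ≤ K₃ := by
      rw [hK₃]
      refine mul_le_of_le_mul_exp_neg one_pos hb0.le (by positivity) (by positivity) ?_
        (by positivity) ?_
      · have : 4 * (1 / σ i + 1) * b = 4 * (b / σ i + b) := by ring
        linarith
      · rw [div_eq_mul_inv, hwl, mul_assoc (8 * (n : ℝ)), ← Real.exp_add]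
        refine (mul_le_mul_of_nonneg_right hP₂ (Real.exp_pos _).le).trans ?_
        rw [mul_assoc (8 * (n : ℝ)), ← Real.exp_add]
        refine mul_le_mul_of_nonneg_left (Real.exp_le_exp.2 ?_) hn
        have h3 := mul_le_mul_of_nonneg_right hM'.le hl
        have h4 : 4 * l / σ i * b = 4 * (b / σ i) * l := by ring
        push_cast
        linarith
    refine hE.trans (ENNReal.ofReal_le_ofReal ?_)
    rw [div_lt_iff₀ (by linarith)] at hbK
    rw [mul_add]
    linarith
  · rw [div_le_iff₀ hc₁0] at hbc₁
    have h1 : (m₀ : ℝ) ≤ N₁ := by linarith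
    have h2 := mul_le_mul_of_nonneg_right (by linarith : c₁ + 1 ≤ C) hb0.le
    have h2 : (N₁ : ℝ) ≤ m₁ b := by linarith
    exact ⟨by exact_mod_cast h1, by exact_mod_cast h2⟩
  · have h1 := mul_le_mul_of_nonneg_right (by linarith : 2 ≤ C) hb0.le
    have h1 : (m₀ : ℝ) ≤ N₂ := by linarith
    have h2 : (N₂ : ℝ) ≤ m₁ b := hN₂.trans hbm₁
    exact ⟨by exact_mod_cast h1, by exact_mod_cast h2⟩
  · have h1 : (m₀ : ℝ) ≤ b / σ i := by rwa [le_div_iff₀ hσi]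
    have h2 : (m₀ : ℝ) ≤ 2 * M := by linarith [(Nat.cast_nonneg M : (0 : ℝ) ≤ M)]
    have h3 : 2 * (M : ℝ) ≤ m₁ b := by
      have : (2 / σ i + 2) * b = 2 * (b / σ i) + 2 * b := by ring
      have := mul_le_mul_of_nonneg_right (by linarith : 2 / σ i + 2 ≤ C) hb0.le
      linarith
    exact ⟨by exact_mod_cast h2, by exact_mod_cast h3⟩

end WindowUpperBound

/-! ### Matching upper and lower bounds combined. -/

theorem theorem4 {n : ℕ} (p q σ : Fin n → ℝ)
    (hp : p ∈ stdSimplex ℝ (Fin n)) (hq : q ∈ stdSimplex ℝ (Fin n)) (hσ : ∀ i, 0 ≤ σ i)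
    (hpq : 0 < weightedForm σ (p - q) (p - q)) :
    (∀ (Ω : Type u) [MeasurableSpace Ω] (μ : Measure Ω) [IsProbabilityMeasure μ]
        (X : ℤ → Ω → Fin n), ChangeAtZero μ p q X →
      Tendsto (fun b : ℝ => expectedTime μ X (scanTime σ b) /
          ENNReal.ofReal (b / (weightedForm σ (p - q) (p - q) / 2)))
        atTop (𝓝 1)) ∧
    ((∃ i, 0 < σ i ∧ 0 < q i ∧ q i < 1) →
      ∃ C : ℝ, 2 / weightedForm σ (p - q) (p - q) < C ∧
        ∀ (m₀ : ℕ) (m₁ : ℝ → ℕ), (∀ᶠ b in atTop, C * b ≤ (m₁ b : ℝ)) →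
          ∀ (Ω : Type u) [MeasurableSpace Ω] (μ : Measure Ω) [IsProbabilityMeasure μ]
            (X : ℤ → Ω → Fin n), ChangeAtZero μ p q X →
          Tendsto (fun b : ℝ => expectedTime μ X (windowScanTime σ m₀ (m₁ b) b) /
              ENNReal.ofReal (b / (weightedForm σ (p - q) (p - q) / 2)))
            atTop (𝓝 1)) := by
  have hdiv : ∀ b : ℝ, b / (weightedForm σ (p - q) (p - q) / 2)
      = 2 / weightedForm σ (p - q) (p - q) * b := fun b => by
    field_simp
  have hd : 0 < 2 / weightedForm σ (p - q) (p - q) := by positivity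
  simp only [hdiv]
  refine ⟨fun Ω _ μ _ X h => ?_, fun ⟨i, hσi, hqi, hqi1⟩ => ?_⟩
  · exact tendsto_div_ofReal_of_eventually_between hd
      (fun c hc => h.eventually_le_expectedTime_scanTime hp hq hσ hpq hc)
      (fun c hc => h.eventually_expectedTime_scanTime_le hp hq hσ hpq hc)
  · obtain ⟨C, hC, hCu⟩ := exists_eventually_expectedTime_windowScanTime_le
      hp hq hσ hpq hσi hqi hqi1
    refine ⟨C, hC, fun m₀ m₁ hm₁ Ω _ μ _ X h => ?_⟩
    refine tendsto_div_ofReal_of_eventually_between hd (fun c hc => ?_) (hCu m₀ m₁ hm₁ Ω μ X h)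
    filter_upwards [h.eventually_le_expectedTime_scanTime hp hq hσ hpq hc] with b hb
    exact hb.trans (lintegral_mono fun ω =>
      ENat.toENNReal_le.2 (scanTime_le_windowScanTime σ m₀ (m₁ b) b _))
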